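/- **Theorem (Normalization Lemma for power series rings over perfect fields of positive characteristic).** Let $k$ be a perfect field of characteristic $p>0$ (finite or infinite), let $n \ge 0$, let $\mathfrak p$ be a prime ideal of $A = k[[X_1,\dots,X_n]]$, and let $e=\dim A/\mathfrak p$ be the Krull dimension; it is an integer with $0\le e\le n$. Then there is a new set of variables $Y_1,\dots,Y_n$ of $A$, that is, power series $Y_1,\dots,Y_n\in A$ with zero constant term such that every element of $A$ can be written in exactly one way as a formal power series in $Y_1,\dots,Y_n$ with coefficients in $k$, such that, writing $B = k[[Y_1,\dots,Y_e]]\subseteq A$ for the subring of formal power series in $Y_1,\dots,Y_e$: 1. $\mathfrak p\cap B=\{0\}$; 2. the induced injective ring homomorphism $B\hookrightarrow A/\mathfrak p$ is finite, that is, $A/\mathfrak p$ is a finitely generated $B$-module; 3. the induced extension of fraction fields $\operatorname{Frac}(B)\hookrightarrow\operatorname{Frac}(A/\mathfrak p)$ is finite and separable. -/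

import Mathlib

/-- A family `Y` of `n` formal power series in `k[[X_1, …, X_n]]` is a *set of variables* (a system
of formal coordinates) if all the `Y i` have zero constant term and every element of
`k[[X_1, …, X_n]]` is, in exactly one way, a formal power series in `Y_1, …, Y_n` (that is, the
substitution `X_i ↦ Y_i` is bijective). -/
def IsSetOfVariables {k : Type*} [Field k] {n : ℕ} (Y : Fin n → MvPowerSeries (Fin n) k) : Prop :=
  (∀ i, MvPowerSeries.constantCoeff (Y i) = 0) ∧
    Function.Bijective
      (MvPowerSeries.subst Y : MvPowerSeries (Fin n) k → MvPowerSeries (Fin n) k)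

/-- The subalgebra `k[[Y_1, …, Y_e]]` of `k[[X_1, …, X_n]]` consisting of all the formal power
series in `Y_1, …, Y_e`, where the `Y i` have zero constant term. -/
noncomputable def seriesSubalgebra {k : Type*} [Field k] {n e : ℕ}
    (Y : Fin e → MvPowerSeries (Fin n) k) (hY : ∀ i, MvPowerSeries.constantCoeff (Y i) = 0) :
    Subalgebra k (MvPowerSeries (Fin n) k) :=
  (MvPowerSeries.substAlgHom (R := k) (MvPowerSeries.hasSubst_of_constantCoeff_zero hY)).range

instance {k : Type*} [Field k] {n e : ℕ} (Y : Fin e → MvPowerSeries (Fin n) k)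
    (hY : ∀ i, MvPowerSeries.constantCoeff (Y i) = 0) : IsDomain (seriesSubalgebra Y hY) :=
  haveI : IsDomain (MvPowerSeries (Fin n) k) := NoZeroDivisors.to_isDomain _
  inferInstance

/-- The natural ring homomorphism `k[[Y_1, …, Y_e]] → k[[X_1, …, X_n]] / P`, sending a series to its
class modulo `P`. -/
noncomputable def seriesToQuotient {k : Type*} [Field k] {n e : ℕ}
    (Y : Fin e → MvPowerSeries (Fin n) k) (hY : ∀ i, MvPowerSeries.constantCoeff (Y i) = 0)
    (P : Ideal (MvPowerSeries (Fin n) k)) :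
    seriesSubalgebra Y hY →+* MvPowerSeries (Fin n) k ⧸ P :=
  (Ideal.Quotient.mk P).comp (seriesSubalgebra Y hY).val.toRingHom

/-- For an injective ring homomorphism `f : R → S` of integral domains, the induced field extension
`Frac R → Frac S` is finite and separable. -/
def FractionFieldExtFiniteSeparable {R S : Type*} [CommRing R] [IsDomain R] [CommRing S]
    [IsDomain S] (f : R →+* S) (hf : Function.Injective f) : Prop :=
  letI : Algebra (FractionRing R) (FractionRing S) :=
    (IsFractionRing.map (K := FractionRing R) (L := FractionRing S) hf).toAlgebra
  FiniteDimensional (FractionRing R) (FractionRing S) ∧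
    Algebra.IsSeparable (FractionRing R) (FractionRing S)

/-!
The proof is by induction on the number of variables, eliminating one variable at a time while
keeping the extension separable. If `P = 0` there is nothing to do.

The point where perfectness enters is `MvPowerSeries.exists_pderiv_notMem`: a nonzero prime `P`
contains some `f` with a partial derivative `∂ᵢ f` outside `P`. Indeed, if `P` were stable under all
`∂ᵢ`, it would be stable under the operators `∂ᵢ ^ (p - 1) Xᵢ ^ (p - 1)`, which up to sign project
onto the monomials whose exponent in `Xᵢ` is divisible by `p`. Applied to a series of least order in
`P`, they produce a nonzero `p`-th power `c ^ p` in `P`, so that `c ∈ P` has smaller order.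

Renaming the variables, let `i = 0`. The substitution `Xⱼ ↦ Xⱼ + X₀ ^ wⱼ` with suitable weights
`wⱼ` makes `f` regular in `X₀`, that is, makes `f(X₀, 0, …, 0)` nonzero
(`exists_weights_unique`, `MvPowerSeries.exists_coeff_single_ne_zero`). This works over finite fields
too, where a linear change of variables need not suffice. As the `wⱼ` can be taken divisible by
`p`, the substitution commutes with `∂₀`, and `∂₀ f ∉ P` is preserved.

By the Weierstrass preparation theorem, `f` is then a unit times a monic polynomial `q` in `X₀` over
`A' = k[[X₁, …, Xₙ]]`. Hence the domain `A / P` is generated over its subring `A' / (P ∩ A')` by the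
class of `X₀`, a root of `q`; as `f ∈ P` and `∂₀ f ∉ P`, this root is simple. So
`A' / (P ∩ A') → A / P` is finite, with a separable extension of fraction fields
(`PowerSeries.isFiniteSeparableEmbedding_of_regular`), and the induction hypothesis applies to
`P ∩ A'`. The new variables are those found for `A'`, followed by `X₀`.

Finally, the number `e` of remaining variables is the dimension of `A / P`, because integral
extensions preserve dimension and `k[[Y₁, …, Yₑ]]` has dimension `e`.
-/

/-! ### Finite separable embeddings -/

section

open Polynomial

/-- An injective finite ring homomorphism of integral domains whose induced extension of fraction
fields is finite and separable. -/
structure IsFiniteSeparableEmbedding {R S : Type*} [CommRing R] [IsDomain R] [CommRing S]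
    [IsDomain S] (f : R →+* S) : Prop where
  injective : Function.Injective f
  finite : f.Finite
  fractionField : FractionFieldExtFiniteSeparable f injective

section

variable {R S T : Type*} [CommRing R] [IsDomain R] [CommRing S] [IsDomain S] [CommRing T]
  [IsDomain T]

theorem IsFiniteSeparableEmbedding.comp {g : S →+* T} {f : R →+* S}
    (hg : IsFiniteSeparableEmbedding g) (hf : IsFiniteSeparableEmbedding f) :
    IsFiniteSeparableEmbedding (g.comp f) := by
  have hinj : Function.Injective (g.comp f) := hg.injective.comp hf.injective
  refine ⟨hinj, hg.finite.comp hf.finite, ?_⟩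
  obtain ⟨h1, h2⟩ := hf.fractionField
  obtain ⟨h3, h4⟩ := hg.fractionField
  let a1 : Algebra (FractionRing R) (FractionRing S) :=
    (IsFractionRing.map (K := FractionRing R) (L := FractionRing S) hf.injective).toAlgebra
  let a2 : Algebra (FractionRing S) (FractionRing T) :=
    (IsFractionRing.map (K := FractionRing S) (L := FractionRing T) hg.injective).toAlgebra
  let a3 : Algebra (FractionRing R) (FractionRing T) :=
    (IsFractionRing.map (K := FractionRing R) (L := FractionRing T) hinj).toAlgebra
  have : IsScalarTower (FractionRing R) (FractionRing S) (FractionRing T) := by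
    refine IsScalarTower.of_algebraMap_eq' ?_
    refine IsLocalization.ringHom_ext (nonZeroDivisors R) ?_
    ext r
    simp [a1, a2, a3, RingHom.algebraMap_toAlgebra, IsFractionRing.map]
  exact ⟨Module.Finite.trans (FractionRing S) _, Algebra.IsSeparable.trans _ (FractionRing S) _⟩

/-- A ring homomorphism is a finite separable embedding as soon as it is injective and its target
is generated by one element that is a simple root of a monic polynomial with coefficients in the
source. -/
theorem IsFiniteSeparableEmbedding.of_simple_root {f : R →+* S} (hf : Function.Injective f) (x : S)
    (hx : ∀ s, ∃ q : R[X], q.eval₂ f x = s) (q : R[X]) (hq : q.Monic) (hq0 : q.eval₂ f x = 0)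
    (hq1 : q.derivative.eval₂ f x ≠ 0) : IsFiniteSeparableEmbedding f := by
  refine ⟨hf, ?_, ?_⟩
  · algebraize [f]
    have hxi : IsIntegral R x := ⟨q, hq, hq0⟩
    have htop : Algebra.adjoin R {x} = ⊤ := by
      refine eq_top_iff.2 fun s _ => ?_
      obtain ⟨r, rfl⟩ := hx s
      exact aeval_mem_adjoin_singleton R x
    have := hxi.fg_adjoin_singleton
    rw [htop] at this
    exact ⟨this⟩
  · let a1 : Algebra (FractionRing R) (FractionRing S) :=
      (IsFractionRing.map (K := FractionRing R) (L := FractionRing S) hf).toAlgebra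
    have key (r : R[X]) : aeval (algebraMap S (FractionRing S) x)
        (r.map (algebraMap R (FractionRing R))) = algebraMap S (FractionRing S) (r.eval₂ f x) := by
      rw [hom_eval₂, aeval_def, eval₂_map]
      congr 1
      ext r
      simp [a1, RingHom.algebraMap_toAlgebra, IsFractionRing.map]
    set K := FractionRing R
    set L := FractionRing S
    set y := algebraMap S L x
    have hyi : IsIntegral K y := by
      refine ⟨q.map (algebraMap R K), hq.map _, ?_⟩
      rw [← aeval_def, key, hq0, map_zero]
    have hys : IsSeparable K y := by
      refine (separable_iff_derivative_ne_zero (minpoly.irreducible hyi)).2 fun h0 => hq1 ?_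
      obtain ⟨c, hc⟩ := minpoly.dvd K y (p := q.map (algebraMap R K)) (by rw [key, hq0, map_zero])
      have := congrArg (fun p => aeval y (derivative p)) hc
      simp only [derivative_mul, h0, zero_mul, zero_add, map_mul, minpoly.aeval] at this
      rw [derivative_map, key] at this
      exact (map_eq_zero_iff _ (IsFractionRing.injective S L)).1 this
    have hmem (s : S) : algebraMap S L s ∈ IntermediateField.adjoin K {y} := by
      obtain ⟨r, rfl⟩ := hx s
      rw [← key]
      exact IntermediateField.algebra_adjoin_le_adjoin K _ (aeval_mem_adjoin_singleton K y)
    have htop : IntermediateField.adjoin K {y} = ⊤ := by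
      refine eq_top_iff.2 fun l _ => ?_
      obtain ⟨a, b, _, rfl⟩ := IsFractionRing.div_surjective (A := S) l
      exact div_mem (hmem a) (hmem b)
    have hfin : FiniteDimensional K (IntermediateField.adjoin K {y}) :=
      IntermediateField.adjoin.finiteDimensional hyi
    have hsep := (IntermediateField.isSeparable_adjoin_simple_iff_isSeparable K L).2 hys
    refine ⟨?_, ⟨fun l => ?_⟩⟩
    · rw [htop] at hfin
      exact Module.Finite.equiv (IntermediateField.topEquiv (F := K) (E := L)).toLinearEquiv
    · exact IntermediateField.isSeparable_of_mem_isSeparable K L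
        (L := IntermediateField.adjoin K {y}) (htop ▸ IntermediateField.mem_top)

theorem IsFiniteSeparableEmbedding.of_bijective {f : R →+* S} (hf : Function.Bijective f) :
    IsFiniteSeparableEmbedding f :=
  .of_simple_root hf.1 0 (fun s => (hf.2 s).imp' C (by simp)) X monic_X (by simp) (by simp)

end

/-- The inductive step of the normalization: if a power series `g` with coefficients in a complete
local ring is regular, is killed by `φ`, and its derivative is not, then by the Weierstrass
preparation theorem the class of the variable generates the target of `φ` and is a simple root of
a monic polynomial. -/
theorem PowerSeries.isFiniteSeparableEmbedding_of_regular {R₀ R S : Type*} [CommRing R₀]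
    [IsLocalRing R₀] [IsAdicComplete (IsLocalRing.maximalIdeal R₀) R₀] [CommRing R] [IsDomain R]
    [CommRing S] [IsDomain S] (π : R₀ →+* R) (φ : PowerSeries R₀ →+* S)
    (hφ : Function.Surjective φ) (ψ : R →+* S) (hψ : Function.Injective ψ)
    (h : ψ.comp π = φ.comp PowerSeries.C) (g : PowerSeries R₀)
    (hreg : g.map (IsLocalRing.residue R₀) ≠ 0) (hg : φ g = 0)
    (hg' : φ (PowerSeries.derivative R₀ g) ≠ 0) : IsFiniteSeparableEmbedding ψ := by
  obtain ⟨q, u, hq⟩ := PowerSeries.exists_isWeierstrassFactorization hreg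
  have key (r : R₀[X]) : (r.map π).eval₂ ψ (φ PowerSeries.X) = φ r := by
    rw [eval₂_map, h, ← hom_eval₂]
    congr 1
    induction r using Polynomial.induction_on' with
    | add p q hp hq => simp [hp, hq]
    | monomial n a => simp [← C_mul_X_pow_eq_monomial]
  have hq0 : φ q = 0 := by
    have := congrArg φ hq.eq_mul
    rw [hg, map_mul] at this
    exact (mul_eq_zero.1 this.symm).resolve_right (hq.isUnit.map φ).ne_zero
  refine .of_simple_root hψ (φ PowerSeries.X) (fun s => ?_) (q.map π)
    (hq.isDistinguishedAt.monic.map π) (by rw [key, hq0]) ?_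
  · obtain ⟨F, rfl⟩ := hφ s
    obtain ⟨a, r, hr⟩ := F.exists_isWeierstrassDivision hreg
    refine ⟨r.map π, ?_⟩
    rw [key]
    conv_rhs => rw [hr.eq_mul_add]
    simp [hg]
  · rw [derivative_map, key, ← PowerSeries.derivative_coe]
    intro h0
    apply hg'
    rw [hq.eq_mul, Derivation.leibniz]
    simp [hq0, h0]

end

/-! ### Krull dimension and completeness -/

/-- Krull dimension is invariant under integral extensions: chains of primes go up, and primes in a
chain upstairs have distinct contractions. -/
theorem RingHom.ringKrullDim_eq_of_isIntegral {R S : Type*} [CommRing R] [CommRing S] (f : R →+* S)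
    (hf : Function.Injective f) (hint : f.IsIntegral) : ringKrullDim S = ringKrullDim R := by
  algebraize [f]
  have : FaithfulSMul R S := (faithfulSMul_iff_algebraMap_injective R S).2 hf
  apply le_antisymm
  · refine Order.krullDim_le_of_strictMono (PrimeSpectrum.comap (algebraMap R S)) ?_
    intro p q hpq
    exact Ideal.IsIntegral.comap_lt_comap hpq
  · refine iSup_le fun l => ?_
    obtain ⟨P, -, _, hP⟩ := Ideal.exists_ideal_over_prime_of_isIntegral l.head.asIdeal (⊥ : Ideal S)
      (fun x hx => by
        have : x = 0 := by simpa using hx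
        simp [this])
    have : P.LiesOver l.head.asIdeal := ⟨hP.symm⟩
    obtain ⟨L, hL, -, -⟩ := Ideal.exists_ltSeries_of_hasGoingUp l P
    exact le_iSup_of_le L (by rw [hL])

theorem PowerSeries.ringKrullDim_eq_succ (R : Type*) [CommRing R] [IsLocalRing R]
    [IsNoetherianRing R] : ringKrullDim (PowerSeries R) = ringKrullDim R + 1 := by
  have hX : (PowerSeries.X : PowerSeries R) ∈ nonZeroDivisors _ :=
    MvPowerSeries.X_mem_nonzeroDivisors
  have hm : (PowerSeries.X : PowerSeries R) ∈ IsLocalRing.maximalIdeal _ := by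
    rw [IsLocalRing.mem_maximalIdeal, mem_nonunits_iff, PowerSeries.isUnit_iff_constantCoeff]
    simp
  rw [← ringKrullDim_quotient_span_singleton_succ_eq_ringKrullDim_of_mem_nonZeroDivisors hX hm]
  congr 1
  have hker : RingHom.ker (PowerSeries.constantCoeff (R := R)) = Ideal.span {PowerSeries.X} := by
    ext f
    rw [RingHom.mem_ker, Ideal.mem_span_singleton, PowerSeries.X_dvd_iff]
  rw [← hker]
  exact ringKrullDim_eq_of_ringEquiv
    (RingHom.quotientKerEquivOfSurjective PowerSeries.constantCoeff_surj)

theorem MvPowerSeries.ringKrullDim_fin (k : Type*) [Field k] (n : ℕ) :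
    ringKrullDim (MvPowerSeries (Fin n) k) = n := by
  induction n with
  | zero =>
    rw [ringKrullDim_eq_of_ringEquiv (MvPowerSeries.isEmptyEquiv (Fin 0) k).toRingEquiv]
    simp
  | succ n ih =>
    rw [ringKrullDim_eq_of_ringEquiv (MvPowerSeries.finSuccEquiv k n).toRingEquiv,
      PowerSeries.ringKrullDim_eq_succ, ih]
    simp

theorem MvPowerSeries.maximalIdeal_eq_span (k : Type*) [Field k] (n : ℕ) :
    IsLocalRing.maximalIdeal (MvPowerSeries (Fin n) k) =
      Ideal.span (Set.range MvPowerSeries.X) := by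
  apply le_antisymm
  · induction n with
    | zero =>
      intro f hf
      have h0 : MvPowerSeries.isEmptyEquiv (Fin 0) k f = 0 := by
        by_contra h
        refine hf (MvPowerSeries.isUnit_iff_constantCoeff.2 ?_)
        exact isUnit_iff_ne_zero.2 h
      rw [(map_eq_zero_iff _ (AlgEquiv.injective _)).1 h0]
      exact zero_mem _
    | succ n ih =>
      intro f hf
      set e := MvPowerSeries.finSuccEquiv k n
      set c := PowerSeries.constantCoeff (e f)
      have hc : c ∈ IsLocalRing.maximalIdeal (MvPowerSeries (Fin n) k) := by
        intro hu
        have := PowerSeries.isUnit_iff_constantCoeff.2 hu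
        exact hf ((MulEquiv.isUnit_map e).1 this)
      have hC : e.symm (PowerSeries.C c) ∈
          Ideal.span (Set.range (MvPowerSeries.X (R := k) (σ := Fin (n + 1)))) := by
        have := Ideal.mem_map_of_mem (e.symm.toRingEquiv.toRingHom.comp PowerSeries.C) (ih hc)
        rw [Ideal.map_span] at this
        refine Ideal.span_mono ?_ this
        rintro _ ⟨_, ⟨j, rfl⟩, rfl⟩
        exact ⟨j.succ, by simp [e, AlgEquiv.eq_symm_apply]⟩
      have hf' : f = MvPowerSeries.X 0 *
          e.symm (PowerSeries.mk fun p => PowerSeries.coeff (p + 1) (e f)) +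
          e.symm (PowerSeries.C c) := by
        apply e.injective
        rw [map_add, map_mul, e.apply_symm_apply, e.apply_symm_apply,
          MvPowerSeries.finSuccEquiv_X_zero]
        exact PowerSeries.eq_X_mul_shift_add_const _
      rw [hf']
      exact add_mem (Ideal.mul_mem_right _ _ (Ideal.subset_span ⟨0, rfl⟩)) hC
  · rw [Ideal.span_le]
    rintro _ ⟨i, rfl⟩
    simp [MvPowerSeries.isUnit_iff_constantCoeff]

theorem MvPowerSeries.isAdicComplete_maximalIdeal (k : Type*) [Field k] (n : ℕ) :
    IsAdicComplete (IsLocalRing.maximalIdeal (MvPowerSeries (Fin n) k))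
      (MvPowerSeries (Fin n) k) := by
  rw [MvPowerSeries.maximalIdeal_eq_span]
  infer_instance

/-! ### Derivatives and primes in characteristic `p` -/

section

open MvPowerSeries

variable {k : Type*} [Field k]

theorem MvPowerSeries.coeff_iterate_pderiv {σ R : Type*} [CommSemiring R] (i : σ) (j : ℕ)
    (f : MvPowerSeries σ R) (m : σ →₀ ℕ) :
    coeff m ((pderiv R i)^[j] f) =
      coeff (m + Finsupp.single i j) f * ((m i + 1).ascFactorial j : ℕ) := by
  induction j generalizing f with
  | zero => simp
  | succ j ih =>
    rw [Function.iterate_succ_apply, ih, coeff_pderiv, add_assoc, ← Finsupp.single_add,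
      Nat.ascFactorial_succ, show (m + Finsupp.single i j) i = m i + j by simp]
    push_cast
    ring

/-- In characteristic `p`, the operator `f ↦ ∂ᵢ^(p-1) (Xᵢ^(p-1) f)` acts diagonally on monomials:
it kills those whose exponent in `Xᵢ` is not divisible by `p`, and no others. -/
theorem MvPowerSeries.coeff_iterate_pderiv_X_pow_mul {σ : Type*} (p : ℕ) [Fact p.Prime] [CharP k p]
    (i : σ) (f : MvPowerSeries σ k) (m : σ →₀ ℕ) :
    coeff m ((pderiv k i)^[p - 1] (X i ^ (p - 1) * f)) ≠ 0 ↔ coeff m f ≠ 0 ∧ p ∣ m i := by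
  have hp : p.Prime := Fact.out
  have h1 : coeff (m + Finsupp.single i (p - 1)) (X i ^ (p - 1) * f) = coeff m f := by
    rw [X_pow_eq, add_comm, coeff_add_monomial_mul, one_mul]
  rw [coeff_iterate_pderiv, h1, mul_ne_zero_iff]
  refine and_congr_right fun _ => ?_
  rw [Ne, CharP.cast_eq_zero_iff k p, Nat.ascFactorial_eq_prod_range, hp.prime.dvd_finsetProd_iff]
  push Not
  constructor
  · intro h
    by_contra hd
    have hr : m i % p ≠ 0 := fun h0 => hd (Nat.dvd_of_mod_eq_zero h0)
    have hlt := Nat.mod_lt (m i) hp.pos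
    -- the factor of the product that is a multiple of `p`
    refine h (p - 1 - m i % p) (by simp; omega) ?_
    have : m i + 1 + (p - 1 - m i % p) = p * (m i / p) + p := by
      have := Nat.div_add_mod (m i) p
      omega
    rw [this]
    exact ⟨m i / p + 1, by ring⟩
  · rintro hd j hj hdj
    rw [add_assoc, Nat.dvd_add_right hd] at hdj
    have := Nat.le_of_dvd (by omega) hdj
    simp at hj
    omega

/-- Over a perfect field of characteristic `p`, a power series whose exponents are all divisible by
`p` is a `p`-th power. -/
theorem MvPowerSeries.exists_pow_eq {σ : Type*} [Finite σ] [PerfectField k] (p : ℕ) [Fact p.Prime]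
    [CharP k p] (f : MvPowerSeries σ k) (hf : ∀ m, coeff m f ≠ 0 → ∀ i, p ∣ m i) :
    ∃ g : MvPowerSeries σ k, g ^ p = f := by
  have : ExpChar k p := ExpChar.prime Fact.out
  have : PerfectRing k p := PerfectField.toPerfectRing p
  have hp : p ≠ 0 := (Fact.out : p.Prime).ne_zero
  let g : MvPowerSeries σ k := fun m => (frobeniusEquiv k p).symm (coeff (p • m) f)
  have hg (m) : coeff m g = (frobeniusEquiv k p).symm (coeff (p • m) f) := rfl
  refine ⟨g, ?_⟩
  rw [← map_frobenius_expand p hp]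
  ext m
  rw [coeff_map]
  by_cases hm : ∀ i, p ∣ m i
  · obtain ⟨m', rfl⟩ : ∃ m', m = p • m' := by
      choose c hc using hm
      refine ⟨Finsupp.equivFunOnFinite.symm c, ?_⟩
      ext i
      simp [hc]
    rw [coeff_expand_smul, hg]
    exact (frobeniusEquiv k p).apply_symm_apply _
  · have h0 : coeff m f = 0 := by
      by_contra h
      exact hm (hf m h)
    push Not at hm
    obtain ⟨i, hi⟩ := hm
    rw [coeff_expand_of_not_dvd p hp g hi, h0, map_zero]

/-- Over a perfect field of positive characteristic, no nonzero prime ideal of a power series ring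
is stable under all partial derivatives. Otherwise a series `f` of least order in it involves a
monomial of least degree that is a `p`-th power, and the operators `∂ᵢ^(p-1) Xᵢ^(p-1)` cut out of
`f` a `p`-th power in the ideal; its `p`-th root has smaller order. -/
theorem MvPowerSeries.exists_pderiv_notMem {σ : Type*} [Finite σ] [PerfectField k] (p : ℕ)
    [Fact p.Prime] [CharP k p] (P : Ideal (MvPowerSeries σ k)) [hP : P.IsPrime] (hP0 : P ≠ ⊥) :
    ∃ f ∈ P, ∃ i, pderiv k i f ∉ P := by
  classical
  by_contra! H
  have hp : p.Prime := Fact.out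
  have hiter (i : σ) (j : ℕ) : ∀ f ∈ P, (pderiv k i)^[j] f ∈ P := by
    induction j with
    | zero => exact fun f hf => hf
    | succ j ih => exact fun f hf => ih _ (H f hf i)
  have hex : ∃ d, ∃ f ∈ P, ∃ m, coeff m f ≠ 0 ∧ m.degree = d := by
    obtain ⟨f, hf, hf0⟩ := Submodule.exists_mem_ne_zero_of_ne_bot hP0
    obtain ⟨m, hm⟩ := (ne_zero_iff_exists_coeff_ne_zero f).1 hf0
    exact ⟨_, f, hf, m, hm, rfl⟩
  obtain ⟨f, hf, m, hm, hd⟩ := Nat.find_spec hex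
  have hmin (g) (hg : g ∈ P) (m') (h : coeff m' g ≠ 0) : m.degree ≤ m'.degree :=
    hd ▸ Nat.find_min' hex ⟨g, hg, m', h, rfl⟩
  -- otherwise `∂ᵢ f` has a monomial of smaller degree
  have hdvd (i : σ) : p ∣ m i := by
    by_contra hi
    have hmi : m i ≠ 0 := fun h => hi (h ▸ dvd_zero p)
    have hle : Finsupp.single i 1 ≤ m := by
      rw [Finsupp.single_le_iff]
      omega
    obtain ⟨m', rfl⟩ : ∃ m', m = m' + Finsupp.single i 1 := ⟨_, (tsub_add_cancel_of_le hle).symm⟩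
    have := hmin _ (H f hf i) m' (by
      rw [coeff_pderiv]
      refine mul_ne_zero hm ?_
      rw [← Nat.cast_one, ← Nat.cast_add, Ne, CharP.cast_eq_zero_iff k p]
      simpa using hi)
    simp at this
  -- remove from `f` the exponents not divisible by `p`, one variable after the other
  have hs (s : Finset σ) : ∃ g ∈ P, coeff m g ≠ 0 ∧ ∀ m', coeff m' g ≠ 0 → ∀ i ∈ s, p ∣ m' i := by
    induction s using Finset.induction_on with
    | empty => exact ⟨f, hf, hm, by simp⟩
    | insert i s _ ih =>
      obtain ⟨g, hg, hgm, hgs⟩ := ih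
      refine ⟨_, hiter i (p - 1) _ (P.mul_mem_left (X i ^ (p - 1)) hg),
        (coeff_iterate_pderiv_X_pow_mul p i g m).2 ⟨hgm, hdvd i⟩, fun m' hm' j hj => ?_⟩
      obtain ⟨h1, h2⟩ := (coeff_iterate_pderiv_X_pow_mul p i g m').1 hm'
      rcases Finset.mem_insert.1 hj with rfl | hj
      exacts [h2, hgs m' h1 j hj]
  have := Fintype.ofFinite σ
  obtain ⟨g, hg, hgm, hgs⟩ := hs Finset.univ
  obtain ⟨c, rfl⟩ := exists_pow_eq p g fun m' hm' i => hgs m' hm' i (Finset.mem_univ i)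
  have hc : c ∈ P := hP.mem_of_pow_mem p hg
  -- as `c ∈ P`, its order is at least `m.degree`, while `c ^ p` has order at most `m.degree`
  have hord : (m.degree : ℕ∞) ≤ c.order := by
    refine le_order fun m' hm' => ?_
    by_contra h
    exact absurd (hmin c hc m' h) (by simpa using hm')
  have hm0 : m.degree ≠ 0 := by
    intro h
    rw [Finsupp.degree_eq_zero_iff] at h
    refine hP.ne_top (Ideal.eq_top_of_isUnit_mem _ hf (isUnit_iff_constantCoeff.2 ?_))
    rw [h] at hm
    exact isUnit_iff_ne_zero.2 hm
  have h2 : (c ^ p).order ≤ m.degree := order_le hgm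
  have h3 : p • c.order ≤ (c ^ p).order := le_order_pow p
  have h4 : ((p * m.degree : ℕ) : ℕ∞) ≤ m.degree := by
    refine le_trans ?_ (h3.trans h2)
    rw [nsmul_eq_mul, Nat.cast_mul]
    gcongr
  have h5 : p * m.degree ≤ m.degree := by exact_mod_cast h4
  nlinarith [hp.two_le, Nat.pos_of_ne_zero hm0]

/-! ### Regularity in the first variable -/

/-- For a nonempty set `S` of exponents, there are weights, the first one `1` and the others divisible
by `p`, and some `m ∈ S` that is the only element of `S` of its weighted degree. By induction, such
weights and such an `m` exist for the elements of `S` with the least last entry; then the last weight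
is chosen larger than the contribution of the other entries of `m`. -/
theorem exists_weights_unique (p : ℕ) (hp : p ≠ 0) (n : ℕ) (S : Set (Fin (n + 1) → ℕ))
    (hS : S.Nonempty) :
    ∃ w : Fin (n + 1) → ℕ, w 0 = 1 ∧ (∀ j, w j ≠ 0) ∧ (∀ j, j ≠ 0 → p ∣ w j) ∧
      ∃ m ∈ S, ∀ m' ∈ S, ∑ j, w j * m' j = ∑ j, w j * m j → m' = m := by
  classical
  induction n with
  | zero =>
    obtain ⟨m, hm⟩ := hS
    refine ⟨fun _ => 1, rfl, by simp, fun j hj => absurd (Fin.fin_one_eq_zero j) hj, m, hm,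
      fun m' _ h => ?_⟩
    ext j
    rw [Fin.fin_one_eq_zero j]
    simpa using h
  | succ n ih =>
    have hex : ∃ a, ∃ m ∈ S, m (Fin.last (n + 1)) = a := ⟨_, hS.some, hS.some_mem, rfl⟩
    obtain ⟨m₀, hm₀, ha⟩ := Nat.find_spec hex
    set a := Nat.find hex
    have hmin (m) (hm : m ∈ S) : a ≤ m (Fin.last (n + 1)) := Nat.find_min' hex ⟨m, hm, rfl⟩
    obtain ⟨w, hw0, hw1, hwp, m, hm, hu⟩ := ih
      {m | (Fin.snoc m a : Fin (n + 2) → ℕ) ∈ S} ⟨Fin.init m₀, by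
        rw [Set.mem_ofPred_eq, ← ha, Fin.snoc_init_self]
        exact hm₀⟩
    set D := ∑ j, w j * m j
    refine ⟨Fin.snoc w (p * (D + 1)), ?_, ?_, ?_, Fin.snoc m a, hm, ?_⟩
    · rw [← Fin.castSucc_zero, Fin.snoc_castSucc, hw0]
    · intro j
      refine Fin.lastCases ?_ (fun j => ?_) j
      · simpa using hp
      · simpa using hw1 j
    · intro j
      refine Fin.lastCases ?_ (fun j => ?_) j
      · simp
      · intro hj
        rw [Fin.snoc_castSucc]
        exact hwp j fun h => hj (by rw [h, Fin.castSucc_zero])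
    · intro m' hm' h
      simp only [Fin.sum_univ_castSucc (n := n + 1), Fin.snoc_castSucc, Fin.snoc_last] at h
      rcases (hmin m' hm').eq_or_lt with h' | h'
      · rw [← h'] at h
        have := hu (Fin.init m') (by
          rw [Set.mem_ofPred_eq, h', Fin.snoc_init_self]
          exact hm') (by
            simpa [Fin.init] using h)
        rw [← this, h', Fin.snoc_init_self]
      · exfalso
        have h1 : p * (D + 1) * (a + 1) ≤ p * (D + 1) * m' (Fin.last (n + 1)) :=
          Nat.mul_le_mul_left _ h'
        have h2 : D + 1 ≤ p * (D + 1) := Nat.le_mul_of_pos_left _ (Nat.pos_of_ne_zero hp)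
        have h3 : ∑ j, w j * m j = D := rfl
        rw [mul_add, mul_one] at h1
        omega

/-- Chain rule for a substitution `U` with `∂₀ U₀ = 1` and `∂₀ Uⱼ = 0` for `j ≠ 0`. -/
theorem MvPowerSeries.pderiv_subst_of_pderiv_eq {σ R : Type*} [CommRing R] [DecidableEq σ] (i : σ)
    {U : σ → MvPowerSeries σ R} (hU : HasSubst U)
    (hd : ∀ j, pderiv R i (U j) = if j = i then 1 else 0) (f : MvPowerSeries σ R) :
    pderiv R i (subst U f) = subst U (pderiv R i f) := by
  let : UniformSpace R := ⊥
  have : DiscreteUniformity R := ⟨rfl⟩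
  open scoped MvPowerSeries.WithPiTopology in
  have hcont : Continuous (pderiv R i : MvPowerSeries σ R → MvPowerSeries σ R) := by
    refine continuous_pi fun d => ?_
    have h : (fun f : MvPowerSeries σ R => pderiv R i f d) =
        fun f => coeff (d + Finsupp.single i 1) f * ((d i : R) + 1) :=
      funext fun f => coeff_pderiv f d
    rw [h]
    exact (WithPiTopology.continuous_coeff R _).mul continuous_const
  have hsub : Continuous (subst U : MvPowerSeries σ R → MvPowerSeries σ R) := continuous_subst hU
  refine congrFun (WithPiTopology.denseRange_toMvPowerSeries.equalizer (hcont.comp hsub)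
    (hsub.comp hcont) (funext fun q => ?_)) f
  simp only [Function.comp_apply]
  rw [pderiv_coe, subst_coe, subst_coe]
  induction q using MvPolynomial.induction_on with
  | C a => simp
  | add p q hp hq => simp [hp, hq]
  | mul_X p j hp =>
    rw [map_mul, MvPolynomial.aeval_X, Derivation.leibniz, Derivation.leibniz, hp, hd,
      MvPolynomial.pderiv_X]
    by_cases h : j = i
    · subst h; simp
    · simp [h]

/-- If some monomial of `f` is the only one of its weighted degree, then substituting
`Xⱼ + X₀ ^ wⱼ` for `Xⱼ` (`j ≠ 0`) makes `f` regular in `X₀`. -/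
theorem MvPowerSeries.exists_coeff_single_ne_zero {n : ℕ} (w : Fin (n + 1) → ℕ) (hw0 : w 0 = 1)
    (hw : ∀ j, w j ≠ 0) (U : Fin (n + 1) → MvPowerSeries (Fin (n + 1)) k) (hU0 : U 0 = X 0)
    (hU : ∀ j, j ≠ 0 → U j = X j + X 0 ^ w j) (f : MvPowerSeries (Fin (n + 1)) k)
    (m : Fin (n + 1) →₀ ℕ) (hm : coeff m f ≠ 0)
    (hu : ∀ m', coeff m' f ≠ 0 → ∑ j, w j * m' j = ∑ j, w j * m j → m' = m) :
    ∃ D, coeff (Finsupp.single 0 D) (subst U f) ≠ 0 := by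
  by_contra! H
  have hUc (j) : constantCoeff (U j) = 0 := by
    by_cases hj : j = 0
    · simp [hj, hU0]
    · simp [hU j hj, hw j]
  let V : Fin (n + 1) → MvPowerSeries (Fin (n + 1)) k := fun j => if j = 0 then X 0 else 0
  let W : Fin (n + 1) → MvPowerSeries (Fin (n + 1)) k := fun j => X 0 ^ w j
  have hV : HasSubst V := hasSubst_of_constantCoeff_zero fun j => by
    by_cases hj : j = 0 <;> simp [V, hj]
  have hW : HasSubst W := hasSubst_of_constantCoeff_zero fun j => by simp [W, hw j]
  have hUs : HasSubst U := hasSubst_of_constantCoeff_zero hUc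
  have hVU : subst V (subst U f) = subst W f := by
    rw [subst_comp_subst_apply hUs hV]
    congr 1
    ext1 j
    by_cases hj : j = 0
    · simp [hj, hU0, subst_X hV, V, W, hw0]
    · rw [hU j hj, subst_add hV, subst_pow hV, subst_X hV, subst_X hV]
      simp [V, W, hj]
  -- after setting `Xⱼ = 0` for `j ≠ 0`, the monomials of `f` become the powers of `X₀` given by
  -- their weighted degrees, so the one coming from `m` does not cancel
  have h1 : coeff (Finsupp.single 0 (∑ j, w j * m j)) (subst W f) = coeff m f := by
    have hprod (d : Fin (n + 1) →₀ ℕ) : (d.prod fun s e => W s ^ e) = X 0 ^ ∑ j, w j * d j := by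
      rw [Finsupp.prod_fintype _ _ (by simp), ← Finset.prod_pow_eq_pow_sum]
      simp [W, pow_mul]
    rw [coeff_subst hW, finsum_eq_single _ m]
    · rw [hprod, coeff_X_pow]
      simp
    · intro d hd
      rw [hprod, coeff_X_pow]
      by_cases h : coeff d f = 0
      · simp [h]
      · rw [if_neg, smul_zero]
        intro h2
        exact hd (hu d h (Finsupp.single_injective _ h2).symm)
  have h2 : subst V (subst U f) = 0 := by
    ext D
    rw [coeff_subst hV, map_zero]
    refine finsum_eq_zero_of_forall_eq_zero fun d => ?_
    by_cases hd : ∃ j, j ≠ 0 ∧ d j ≠ 0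
    · obtain ⟨j, hj, hdj⟩ := hd
      rw [Finsupp.prod_fintype _ _ (by simp),
        Finset.prod_eq_zero (Finset.mem_univ j) (by simp [V, hj, hdj])]
      simp
    · push Not at hd
      have : d = Finsupp.single 0 (d 0) := by
        ext j
        by_cases hj : j = 0
        · simp [hj]
        · simp [hd j hj, hj]
      rw [this, H, zero_smul]
  rw [← hVU, h2, map_zero] at h1
  exact hm h1.symm

/-- A power series involving a pure power of `X₀` is regular as a series in `X₀`. -/
theorem MvPowerSeries.map_residue_finSuccEquiv_ne_zero {n D : ℕ}
    (f : MvPowerSeries (Fin (n + 1)) k) (hf : coeff (Finsupp.single 0 D) f ≠ 0) :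
    (finSuccEquiv k n f).map (IsLocalRing.residue (MvPowerSeries (Fin n) k)) ≠ 0 := by
  intro h
  have := congrArg (PowerSeries.coeff D) h
  rw [PowerSeries.coeff_map, map_zero, IsLocalRing.residue_eq_zero_iff,
    IsLocalRing.mem_maximalIdeal, mem_nonunits_iff, isUnit_iff_constantCoeff, isUnit_iff_ne_zero,
    not_not, ← coeff_zero_eq_constantCoeff_apply, coeff_coeff_finSuccEquiv] at this
  exact hf (by rwa [Finsupp.cons_zero_eq_single_zero] at this)

theorem MvPowerSeries.finSuccEquiv_pderiv_zero {n : ℕ} (f : MvPowerSeries (Fin (n + 1)) k) :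
    finSuccEquiv k n (pderiv k 0 f) = PowerSeries.derivative _ (finSuccEquiv k n f) := by
  ext d x
  rw [coeff_coeff_finSuccEquiv, coeff_pderiv, PowerSeries.coeff_derivative,
    ← Nat.cast_succ d, ← nsmul_eq_mul', map_nsmul, coeff_coeff_finSuccEquiv, nsmul_eq_mul']
  have : x.cons d + Finsupp.single 0 1 = x.cons (d + 1) := by
    ext j
    refine Fin.cases ?_ (fun j => ?_) j <;> simp
  simp [this]

theorem MvPowerSeries.finSuccEquiv_rename_succ {n : ℕ} (f : MvPowerSeries (Fin n) k) :
    finSuccEquiv k n (rename Fin.succ f) = PowerSeries.C f := by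
  ext d x
  rw [coeff_coeff_finSuccEquiv, PowerSeries.coeff_C]
  split_ifs with h
  · subst h
    have : x.cons 0 = x.embDomain (Fin.succEmb n) := by
      ext j
      refine Fin.cases ?_ (fun j => ?_) j
      · rw [Finsupp.cons_zero, Finsupp.embDomain_of_notMem_range]
        simp
      · rw [Finsupp.cons_succ, ← Fin.coe_succEmb, Finsupp.embDomain_apply_self]
    rw [this]
    exact coeff_embDomain_rename (Fin.succEmb n) f x
  · rw [map_zero]
    refine coeff_rename_eq_zero _ _ ?_
    rintro ⟨y, hy⟩
    have := DFunLike.congr_fun hy 0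
    rw [Finsupp.cons_zero, Finsupp.mapDomain_of_notMem_range _ _ (by simp)] at this
    exact h this.symm

end

/-! ### Sets of variables -/

section

open MvPowerSeries

variable {k : Type*} [Field k] {n : ℕ}

theorem MvPowerSeries.isDomain_of_field (σ : Type*) : IsDomain (MvPowerSeries σ k) :=
  NoZeroDivisors.to_isDomain _

attribute [local instance] MvPowerSeries.isDomain_of_field

/-- The ring homomorphism `k[[T₁, …, Tₑ]] → k[[X₁, …, Xₙ]] / P` sending `Tᵢ` to the class of `Zᵢ`. -/
noncomputable def substMod {e : ℕ} (Z : Fin e → MvPowerSeries (Fin n) k)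
    (hZ : ∀ i, constantCoeff (Z i) = 0) (P : Ideal (MvPowerSeries (Fin n) k)) :
    MvPowerSeries (Fin e) k →+* MvPowerSeries (Fin n) k ⧸ P :=
  (Ideal.Quotient.mk P).comp (substAlgHom (R := k) (hasSubst_of_constantCoeff_zero hZ)).toRingHom

theorem substMod_apply {e : ℕ} (Z : Fin e → MvPowerSeries (Fin n) k)
    (hZ : ∀ i, constantCoeff (Z i) = 0) (P : Ideal (MvPowerSeries (Fin n) k))
    (f : MvPowerSeries (Fin e) k) : substMod Z hZ P f = Ideal.Quotient.mk P (subst Z f) := by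
  rw [← coe_substAlgHom (hasSubst_of_constantCoeff_zero hZ)]
  rfl

/-- The prime `P` has a separable normalization: in suitable variables `Y₁, …, Yₙ`, the map
`k[[Y₁, …, Yₑ]] → k[[X₁, …, Xₙ]] / P` is injective and finite, and the extension of fraction
fields is separable. Power series in `Y₁, …, Yₑ` are parametrized by an abstract power series
ring in `e` variables. -/
def HasSeparableNormalization (P : Ideal (MvPowerSeries (Fin n) k)) [P.IsPrime] : Prop :=
  ∃ (e : ℕ) (hen : e ≤ n) (Y : Fin n → MvPowerSeries (Fin n) k) (hY : IsSetOfVariables Y),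
    IsFiniteSeparableEmbedding
      (substMod (fun i => Y (Fin.castLE hen i)) (fun i => hY.1 (Fin.castLE hen i)) P)

theorem IsSetOfVariables.of_inverse (Y V : Fin n → MvPowerSeries (Fin n) k)
    (hY : ∀ i, constantCoeff (Y i) = 0) (hV : ∀ i, constantCoeff (V i) = 0)
    (hVY : ∀ i, subst V (Y i) = X i) (hYV : ∀ i, subst Y (V i) = X i) : IsSetOfVariables Y := by
  have hYs : HasSubst Y := hasSubst_of_constantCoeff_zero hY
  have hVs : HasSubst V := hasSubst_of_constantCoeff_zero hV
  refine ⟨hY, Function.bijective_iff_has_inverse.2 ⟨subst V, fun f => ?_, fun f => ?_⟩⟩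
  · rw [subst_comp_subst_apply hYs hVs, funext hVY, subst_self, id]
  · rw [subst_comp_subst_apply hVs hYs, funext hYV, subst_self, id]

theorem constantCoeff_subst_of_constantCoeff_zero {Y : Fin n → MvPowerSeries (Fin n) k}
    (hY : ∀ i, constantCoeff (Y i) = 0) (f : MvPowerSeries (Fin n) k) :
    constantCoeff (subst Y f) = constantCoeff f := by
  have hs : HasSubst Y := hasSubst_of_constantCoeff_zero hY
  have h : constantCoeff (subst Y (f - C (constantCoeff f))) = 0 :=
    constantCoeff_subst_eq_zero hs hY (by simp)
  have hC : subst Y (C (constantCoeff f)) = C (constantCoeff f) := by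
    rw [← coe_substAlgHom hs]
    exact (substAlgHom (R := k) hs).commutes (constantCoeff f)
  rwa [subst_sub hs, hC, map_sub, constantCoeff_C, sub_eq_zero] at h

theorem IsSetOfVariables.exists_inverse {Y : Fin n → MvPowerSeries (Fin n) k}
    (hY : IsSetOfVariables Y) : ∃ V : Fin n → MvPowerSeries (Fin n) k,
      (∀ i, constantCoeff (V i) = 0) ∧ (∀ i, subst V (Y i) = X i) ∧ ∀ i, subst Y (V i) = X i := by
  choose V hV using fun i => hY.2.2 (X i)
  have hV0 (i) : constantCoeff (V i) = 0 := by
    rw [← constantCoeff_subst_of_constantCoeff_zero hY.1, hV, constantCoeff_X]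
  refine ⟨V, hV0, fun i => hY.2.1 ?_, hV⟩
  have hYs : HasSubst Y := hasSubst_of_constantCoeff_zero hY.1
  rw [subst_comp_subst_apply (hasSubst_of_constantCoeff_zero hV0) hYs, funext hV, subst_self,
    subst_X hYs, id]

theorem isSetOfVariables_X : IsSetOfVariables (X : Fin n → MvPowerSeries (Fin n) k) :=
  ⟨fun i => constantCoeff_X i, by rw [subst_self]; exact Function.bijective_id⟩

/-- The property of having a separable normalization is invariant under changes of variables. -/
theorem HasSeparableNormalization.of_comap {W : Fin n → MvPowerSeries (Fin n) k}
    (hW : IsSetOfVariables W) (P : Ideal (MvPowerSeries (Fin n) k)) [P.IsPrime]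
    (h : HasSeparableNormalization
      (P.comap (substAlgHom (R := k) (hasSubst_of_constantCoeff_zero hW.1)))) :
    HasSeparableNormalization P := by
  obtain ⟨e, hen, Y, hY, h⟩ := h
  have hWs : HasSubst W := hasSubst_of_constantCoeff_zero hW.1
  have hYs : HasSubst Y := hasSubst_of_constantCoeff_zero hY.1
  have hYW0 (i) : constantCoeff (subst W (Y i)) = 0 := by
    rw [constantCoeff_subst_of_constantCoeff_zero hW.1, hY.1]
  have hYW : IsSetOfVariables (fun i => subst W (Y i)) := by
    refine ⟨hYW0, ?_⟩
    rw [← subst_comp_subst hYs hWs]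
    exact hW.2.comp hY.2
  refine ⟨e, hen, _, hYW, ?_⟩
  set θ : MvPowerSeries (Fin n) k →+* MvPowerSeries (Fin n) k :=
    (substAlgHom (R := k) hWs).toRingHom
  have hθ (f) : θ f = subst W f := by
    rw [← coe_substAlgHom hWs]; rfl
  have hq : Function.Bijective (Ideal.quotientMap P θ le_rfl) := by
    refine ⟨Ideal.quotientMap_injective, Ideal.quotientMap_surjective fun f => ?_⟩
    obtain ⟨g, hg⟩ := hW.2.2 f
    exact ⟨g, (hθ g).trans hg⟩
  have := (IsFiniteSeparableEmbedding.of_bijective hq).comp h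
  convert this using 1
  ext1 f
  have hZs : HasSubst fun i => Y (Fin.castLE hen i) :=
    hasSubst_of_constantCoeff_zero fun i => hY.1 _
  change _ = Ideal.Quotient.mk P (θ (substAlgHom (R := k) hZs f))
  rw [substMod_apply, hθ, substAlgHom_apply, subst_comp_subst_apply hZs hWs]

theorem subst_rename {m l : ℕ} (a : Fin n → Fin m) {V : Fin m → MvPowerSeries (Fin l) k}
    (hV : ∀ i, constantCoeff (V i) = 0) (f : MvPowerSeries (Fin n) k) :
    subst V (rename a f) = subst (fun i => V (a i)) f := by
  rw [rename_eq_subst, subst_comp_subst_apply (HasSubst.X_comp _)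
    (hasSubst_of_constantCoeff_zero hV)]
  congr 1
  ext1 i
  exact subst_X (hasSubst_of_constantCoeff_zero hV) _

theorem rename_subst {m l : ℕ} (a : Fin m → Fin l) {Y : Fin n → MvPowerSeries (Fin m) k}
    (hY : ∀ i, constantCoeff (Y i) = 0) (f : MvPowerSeries (Fin n) k) :
    rename a (subst Y f) = subst (fun i => rename a (Y i)) f := by
  rw [rename_eq_subst, subst_comp_subst_apply (hasSubst_of_constantCoeff_zero hY)
    (HasSubst.X_comp _)]
  simp_rw [rename_eq_subst]

/-- Variables of `k[[X₁, …, Xₙ]]`, followed by `X₀`, form a set of variables of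
`k[[X₀, …, Xₙ]]`. -/
theorem IsSetOfVariables.snoc {Y : Fin n → MvPowerSeries (Fin n) k} (hY : IsSetOfVariables Y) :
    IsSetOfVariables (Fin.snoc (fun i => rename Fin.succ (Y i)) (X 0) :
      Fin (n + 1) → MvPowerSeries (Fin (n + 1)) k) := by
  obtain ⟨V, hV, hVY, hYV⟩ := hY.exists_inverse
  have h1 : ∀ i, constantCoeff ((Fin.snoc (fun i => rename Fin.succ (Y i)) (X 0) :
      Fin (n + 1) → MvPowerSeries (Fin (n + 1)) k) i) = 0 := by
    intro i
    refine Fin.lastCases ?_ (fun i => ?_) i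
    · simp
    · simp [hY.1]
  have h2 : ∀ i, constantCoeff ((Fin.cons (X (Fin.last n)) (fun i => rename Fin.castSucc (V i)) :
      Fin (n + 1) → MvPowerSeries (Fin (n + 1)) k) i) = 0 := by
    intro i
    refine Fin.cases ?_ (fun i => ?_) i
    · simp
    · simp [hV]
  refine .of_inverse _ _ h1 h2 (fun i => ?_) (fun i => ?_)
  · refine Fin.lastCases ?_ (fun i => ?_) i
    · rw [Fin.snoc_last, subst_X (hasSubst_of_constantCoeff_zero h2), Fin.cons_zero]
    · rw [Fin.snoc_castSucc, subst_rename _ h2]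
      simp only [Fin.cons_succ]
      rw [← rename_subst _ hV, hVY, rename_X]
  · refine Fin.cases ?_ (fun i => ?_) i
    · rw [Fin.cons_zero, subst_X (hasSubst_of_constantCoeff_zero h1), Fin.snoc_last]
    · rw [Fin.cons_succ, subst_rename _ h1]
      simp only [Fin.snoc_castSucc]
      rw [← rename_subst _ hY.1, hYV, rename_X]

/-! ### Eliminating one variable -/

theorem HasSeparableNormalization.bot :
    HasSeparableNormalization (⊥ : Ideal (MvPowerSeries (Fin n) k)) := by
  refine ⟨n, le_rfl, X, isSetOfVariables_X, .of_bijective ?_⟩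
  have h : substMod (fun i : Fin n => X (Fin.castLE le_rfl i)) (fun i => constantCoeff_X _)
      (⊥ : Ideal (MvPowerSeries (Fin n) k)) = Ideal.Quotient.mk ⊥ := by
    ext1 f
    rw [substMod_apply]
    exact congrArg _ (congrFun subst_self f)
  rw [h]
  refine ⟨?_, Ideal.Quotient.mk_surjective⟩
  rw [RingHom.injective_iff_ker_eq_bot, Ideal.mk_ker]

/-- Elimination of `X₀`: if `f ∈ P` is regular in `X₀` and `∂₀ f ∉ P`, a separable normalization of
the contraction of `P` to `k[[X₁, …, Xₙ]]` gives one of `P`. -/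
theorem HasSeparableNormalization.of_regular (P : Ideal (MvPowerSeries (Fin (n + 1)) k))
    [P.IsPrime] {f : MvPowerSeries (Fin (n + 1)) k} (hf : f ∈ P) (hf' : pderiv k 0 f ∉ P) {D : ℕ}
    (hD : coeff (Finsupp.single 0 D) f ≠ 0)
    (h : HasSeparableNormalization (P.comap (rename (R := k) (Fin.succ : Fin n → Fin (n + 1))))) :
    HasSeparableNormalization P := by
  obtain ⟨e, hen, Y, hY, h⟩ := h
  refine ⟨e, hen.trans n.le_succ, _, hY.snoc, ?_⟩
  set ρ : MvPowerSeries (Fin n) k →+* MvPowerSeries (Fin (n + 1)) k :=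
    (rename (R := k) (Fin.succ : Fin n → Fin (n + 1))).toRingHom
  have hstep : IsFiniteSeparableEmbedding (Ideal.quotientMap (I := P.comap ρ) P ρ le_rfl) := by
    have := isAdicComplete_maximalIdeal k n
    let E := finSuccEquiv k n
    refine PowerSeries.isFiniteSeparableEmbedding_of_regular (Ideal.Quotient.mk _)
      ((Ideal.Quotient.mk P).comp E.symm.toRingEquiv.toRingHom)
      (Ideal.Quotient.mk_surjective.comp E.symm.surjective) _ Ideal.quotientMap_injective ?_ (E f)
      (map_residue_finSuccEquiv_ne_zero f hD) ?_ ?_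
    · ext1 g
      rw [RingHom.comp_apply, Ideal.quotientMap_mk]
      change _ = Ideal.Quotient.mk P (E.symm (PowerSeries.C g))
      rw [← finSuccEquiv_rename_succ, E.symm_apply_apply]
      rfl
    · change Ideal.Quotient.mk P (E.symm (E f)) = 0
      rwa [E.symm_apply_apply, Ideal.Quotient.eq_zero_iff_mem]
    · rw [← finSuccEquiv_pderiv_zero]
      change Ideal.Quotient.mk P (E.symm (E _)) ≠ 0
      rwa [E.symm_apply_apply, Ne, Ideal.Quotient.eq_zero_iff_mem]
  have := hstep.comp h
  convert this using 1
  ext1 g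
  have hZs : HasSubst fun i => Y (Fin.castLE hen i) :=
    hasSubst_of_constantCoeff_zero fun i => hY.1 _
  change _ = Ideal.Quotient.mk P (rename Fin.succ (substAlgHom (R := k) hZs g))
  rw [substMod_apply, substAlgHom_apply, rename_subst _ fun i => hY.1 _]
  congr 2
  ext1 i
  have : Fin.castLE (hen.trans n.le_succ) i = (Fin.castLE hen i).castSucc := rfl
  rw [this, Fin.snoc_castSucc]

/-- A series `f ∈ P` with `∂₀ f ∉ P` becomes regular in `X₀` after a substitution
`Xⱼ ↦ Xⱼ + X₀ ^ wⱼ`. As `p ∣ wⱼ`, this substitution commutes with `∂₀`, and so `∂₀ f ∉ P` is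
preserved. -/
theorem HasSeparableNormalization.of_pderiv_zero (p : ℕ) [Fact p.Prime] [CharP k p]
    (ih : ∀ (Q : Ideal (MvPowerSeries (Fin n) k)) [Q.IsPrime], HasSeparableNormalization Q)
    (P : Ideal (MvPowerSeries (Fin (n + 1)) k)) [P.IsPrime] {f : MvPowerSeries (Fin (n + 1)) k}
    (hf : f ∈ P) (hf' : pderiv k 0 f ∉ P) : HasSeparableNormalization P := by
  have hp : p.Prime := Fact.out
  have hf0 : f ≠ 0 := by
    rintro rfl
    exact hf' (by simp)
  obtain ⟨m₀, hm₀⟩ := (ne_zero_iff_exists_coeff_ne_zero f).1 hf0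
  obtain ⟨w, hw0, hw, hwp, m, hm, hu⟩ := exists_weights_unique p hp.ne_zero n
    {m | coeff (Finsupp.equivFunOnFinite.symm m) f ≠ 0} ⟨m₀, by simpa using hm₀⟩
  let U : Fin (n + 1) → MvPowerSeries (Fin (n + 1)) k :=
    fun j => if j = 0 then X 0 else X j + X 0 ^ w j
  let W : Fin (n + 1) → MvPowerSeries (Fin (n + 1)) k :=
    fun j => if j = 0 then X 0 else X j - X 0 ^ w j
  have hU0 : U 0 = X 0 := by simp [U]
  have hW0 : W 0 = X 0 := by simp [W]
  have hUj (j) (hj : j ≠ 0) : U j = X j + X 0 ^ w j := by simp [U, hj]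
  have hWj (j) (hj : j ≠ 0) : W j = X j - X 0 ^ w j := by simp [W, hj]
  have hUc (j) : constantCoeff (U j) = 0 := by
    by_cases hj : j = 0 <;> simp [U, hj, hw j]
  have hWc (j) : constantCoeff (W j) = 0 := by
    by_cases hj : j = 0 <;> simp [W, hj, hw j]
  have hUs : HasSubst U := hasSubst_of_constantCoeff_zero hUc
  have hWs : HasSubst W := hasSubst_of_constantCoeff_zero hWc
  have hUW (j) : subst U (W j) = X j := by
    by_cases hj : j = 0
    · rw [hj, hW0, subst_X hUs, hU0]
    · rw [hWj j hj, subst_sub hUs, subst_pow hUs, subst_X hUs, subst_X hUs, hUj j hj, hU0]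
      ring
  have hWU (j) : subst W (U j) = X j := by
    by_cases hj : j = 0
    · rw [hj, hU0, subst_X hWs, hW0]
    · rw [hUj j hj, subst_add hWs, subst_pow hWs, subst_X hWs, subst_X hWs, hWj j hj, hW0]
      ring
  have hW : IsSetOfVariables W := .of_inverse W U hWc hUc hUW hWU
  have hinv (g) : subst W (subst U g) = g := by
    rw [subst_comp_subst_apply hUs hWs, funext hWU, subst_self, id]
  have hd (j) : pderiv k 0 (U j) = if j = 0 then 1 else 0 := by
    by_cases hj : j = 0
    · simp [hj, hU0]
    · have : ((w j : ℕ) : MvPowerSeries (Fin (n + 1)) k) = 0 := by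
        rw [← map_natCast (C : k →+* MvPowerSeries (Fin (n + 1)) k),
          (CharP.cast_eq_zero_iff k p _).2 (hwp j hj), map_zero]
      rw [hUj j hj, map_add, pderiv_X_of_ne hj, pderiv_pow, this, if_neg hj]
      simp
  obtain ⟨D, hD⟩ := exists_coeff_single_ne_zero w hw0 hw U hU0 hUj f
    (Finsupp.equivFunOnFinite.symm m) hm fun m' h1 h2 => by
      have := hu m' (by simpa using h1) h2
      rw [← this, Finsupp.equivFunOnFinite_symm_coe]
  refine .of_comap hW P (.of_regular _ (f := subst U f) ?_ ?_ hD (ih _))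
  · rw [Ideal.mem_comap, substAlgHom_apply, hinv]
    exact hf
  · rw [pderiv_subst_of_pderiv_eq 0 hUs hd, Ideal.mem_comap, substAlgHom_apply, hinv]
    exact hf'

theorem MvPowerSeries.pderiv_rename_equiv {σ τ R : Type*} [CommSemiring R] (e : σ ≃ τ) (i : σ)
    (f : MvPowerSeries σ R) : pderiv R (e i) (rename e f) = rename e (pderiv R i f) := by
  ext x
  obtain ⟨y, rfl⟩ : ∃ y, x = Finsupp.embDomain e.toEmbedding y :=
    ⟨x.mapDomain e.symm, by
      rw [Finsupp.embDomain_eq_mapDomain, ← Finsupp.mapDomain_comp]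
      simp⟩
  have h (g : MvPowerSeries σ R) (y) : coeff (Finsupp.embDomain e.toEmbedding y) (rename e g) =
      coeff y g := coeff_embDomain_rename e.toEmbedding g y
  have hy : Finsupp.embDomain e.toEmbedding y + Finsupp.single (e i) 1 =
      Finsupp.embDomain e.toEmbedding (y + Finsupp.single i 1) := by
    simp [Finsupp.embDomain_eq_mapDomain, Finsupp.mapDomain_add]
  have hyi : Finsupp.embDomain e.toEmbedding y (e i) = y i :=
    Finsupp.embDomain_apply_self e.toEmbedding y i
  rw [h, coeff_pderiv, coeff_pderiv, hy, h, hyi]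

theorem hasSeparableNormalization [PerfectField k] (p : ℕ) [Fact p.Prime] [CharP k p]
    (P : Ideal (MvPowerSeries (Fin n) k)) [P.IsPrime] : HasSeparableNormalization P := by
  induction n with
  | zero =>
    by_cases hP : P = ⊥
    · subst hP
      exact .bot
    · obtain ⟨_, _, i, _⟩ := exists_pderiv_notMem p P hP
      exact i.elim0
  | succ n ih =>
    by_cases hP : P = ⊥
    · subst hP
      exact .bot
    · obtain ⟨f, hf, i, hfi⟩ := exists_pderiv_notMem p P hP
      -- rename the variables so that `Xᵢ` becomes `X₀`
      let e : Fin (n + 1) ≃ Fin (n + 1) := Equiv.swap i 0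
      have he (g : MvPowerSeries (Fin (n + 1)) k) : subst (X ∘ e.symm) (rename e g) = g := by
        rw [← rename_eq_subst]
        exact (renameEquiv k e).symm_apply_apply g
      have hW : IsSetOfVariables (X ∘ e.symm : Fin (n + 1) → MvPowerSeries _ k) :=
        .of_inverse _ (X ∘ e) (by simp) (by simp)
          (fun j => by rw [← rename_eq_subst]; simp) (fun j => by rw [← rename_eq_subst]; simp)
      have hpd : pderiv k 0 (rename e f) = rename e (pderiv k i f) := by
        rw [← pderiv_rename_equiv, Equiv.swap_apply_left]
      refine .of_comap hW P (.of_pderiv_zero p (fun Q _ => ih Q) _ (f := rename e f) ?_ ?_)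
      · rw [Ideal.mem_comap, substAlgHom_apply, he]
        exact hf
      · rw [hpd, Ideal.mem_comap, substAlgHom_apply, he]
        exact hfi

end

theorem theoremA6 {k : Type*} [Field k] [PerfectField k] (p : ℕ) (hp : p.Prime) [CharP k p]
    (n : ℕ) (P : Ideal (MvPowerSeries (Fin n) k)) [P.IsPrime] :
    ∃ (e : ℕ) (hen : e ≤ n),
      ringKrullDim (MvPowerSeries (Fin n) k ⧸ P) = (e : WithBot ℕ∞) ∧
      ∃ (Y : Fin n → MvPowerSeries (Fin n) k) (_ : IsSetOfVariables Y)
        (Z : Fin e → MvPowerSeries (Fin n) k) (hZ : ∀ i, MvPowerSeries.constantCoeff (Z i) = 0),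
        (∀ i : Fin e, Z i = Y (Fin.castLE hen i)) ∧
        (P : Set (MvPowerSeries (Fin n) k)) ∩
          (seriesSubalgebra Z hZ : Set (MvPowerSeries (Fin n) k)) = {0} ∧
        (seriesToQuotient Z hZ P).Finite ∧
        ∃ hinj : Function.Injective (seriesToQuotient Z hZ P),
          FractionFieldExtFiniteSeparable (seriesToQuotient Z hZ P) hinj := by
  have : Fact p.Prime := ⟨hp⟩
  have := MvPowerSeries.isDomain_of_field (k := k) (Fin n)
  obtain ⟨e, hen, Y, hY, h⟩ := hasSeparableNormalization p P
  set Z : Fin e → MvPowerSeries (Fin n) k := fun i => Y (Fin.castLE hen i)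
  have hZ (i) : MvPowerSeries.constantCoeff (Z i) = 0 := hY.1 _
  have := MvPowerSeries.isDomain_of_field (k := k) (Fin e)
  -- `k[[T₁, …, Tₑ]]` is isomorphic to `k[[Y₁, …, Yₑ]]`, compatibly with the maps to the quotient
  have hcomp (f) : seriesToQuotient Z hZ P
      ((MvPowerSeries.substAlgHom (R := k)
        (MvPowerSeries.hasSubst_of_constantCoeff_zero hZ)).rangeRestrict f) = substMod Z hZ P f :=
    rfl
  let E : MvPowerSeries (Fin e) k ≃+* seriesSubalgebra Z hZ := RingEquiv.ofBijective
    (MvPowerSeries.substAlgHom (R := k)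
      (MvPowerSeries.hasSubst_of_constantCoeff_zero hZ)).rangeRestrict
    ⟨fun f g hfg => h.injective
      ((hcomp f).symm.trans ((congrArg (seriesToQuotient Z hZ P) hfg).trans (hcomp g))), AlgHom.rangeRestrict_surjective _⟩
  have hgood : IsFiniteSeparableEmbedding (seriesToQuotient Z hZ P) := by
    have := h.comp (IsFiniteSeparableEmbedding.of_bijective (f := E.symm.toRingHom) E.symm.bijective)
    convert this using 1
    ext1 b
    obtain ⟨f, rfl⟩ := E.surjective b
    change _ = substMod Z hZ P (E.symm (E f))
    rw [E.symm_apply_apply]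
    exact hcomp f
  refine ⟨e, hen, ?_, Y, hY, Z, hZ, fun i => rfl, ?_, hgood.finite, hgood.injective,
    hgood.fractionField⟩
  · rw [RingHom.ringKrullDim_eq_of_isIntegral _ h.injective h.finite.to_isIntegral,
      MvPowerSeries.ringKrullDim_fin]
  · refine Set.eq_singleton_iff_unique_mem.2 ⟨⟨P.zero_mem, zero_mem _⟩, fun b hb => ?_⟩
    have h0 : seriesToQuotient Z hZ P ⟨b, hb.2⟩ = 0 := Ideal.Quotient.eq_zero_iff_mem.2 hb.1
    exact congrArg Subtype.val ((map_eq_zero_iff _ hgood.injective).1 h0)
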